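/- For every nonnegative integer $d\neq 1$ and every $0<\varepsilon<\frac1{10}$ there exist a finite set $G$, a probability distribution $D$ on $G$, and a linear family $\mathcal F$ of functions $f:G\to\mathbb R$ (a linear subspace of $\mathbb R^G$) of dimension $d$ such that the following holds, where $\|h\|_D=\big(\mathbb E_{x\sim D}[|h(x)|^2]\big)^{1/2}$. Consider any (possibly randomized and adaptive) algorithm that makes $m$ queries: the $i$-th query point $x_i\in G$ may depend on the algorithm's internal randomness and on the earlier observations $y_1,\dots,y_{i-1}$, the answer is $y_i=f(x_i)+g_i$, where the noises $g_1,\dots,g_m$ are i.i.d. Gaussian $N(0,\frac1\varepsilon)$ (mean $0$, variance $\frac1\varepsilon$) and independent of the internal randomness, and after $m$ queries the algorithm outputs a function $\widetilde f:G\to\mathbb R$. If for every $f\in\mathcal F$ with $\|f\|_D=1$ the output satisfies $\|f-\widetilde f\|_D\le 0.1$ with probability at least $\frac34$ over the noise and the internal randomness, then $$m\ \ge\ \frac{0.8\,d}{\varepsilon}.$$ -/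

import Mathlib

open MeasureTheory ProbabilityTheory
open scoped ENNReal NNReal

/-- A (possibly randomized and adaptive) algorithm that makes `m` queries to a noisy function on
the domain `G`. Its internal randomness is a seed in `Ω`. The `k`-th query point (counting from
`0`) may depend on the seed and on the `k` observations made so far, and the output, an arbitrary
real function on `G`, may depend on the seed and on all `m` observations. -/
structure QueryAlgorithm (Ω G : Type*) [MeasurableSpace Ω] [MeasurableSpace G] (m : ℕ) where
  query : (k : Fin m) → Ω × (Fin k → ℝ) → G
  measurable_query : ∀ k, Measurable (query k)
  output : Ω × (Fin m → ℝ) → (G → ℝ)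
  measurable_output : Measurable output

namespace QueryAlgorithm

variable {Ω G : Type*} [MeasurableSpace Ω] [MeasurableSpace G] {m : ℕ}

/-- The first `k` observations made by the algorithm on the function `f`, with seed `ω`, when
`g i` is the noise added to the answer of the `i`-th query: the `i`-th observation is
`f (xᵢ) + g i`, where `xᵢ` is the `i`-th query point. -/
def observations (A : QueryAlgorithm Ω G m) (f : G → ℝ) (ω : Ω) :
    (k : ℕ) → k ≤ m → (Fin k → ℝ) → (Fin k → ℝ)
  | 0, _, _ => Fin.elim0
  | k + 1, hk, g =>
    let y : Fin k → ℝ := A.observations f ω k (Nat.le_of_succ_le hk) (Fin.init g)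
    Fin.snoc (α := fun _ => ℝ) y (f (A.query ⟨k, hk⟩ (ω, y)) + g (Fin.last k))

/-- The function that the algorithm outputs on `f`, with seed `ω` and noise `g`. -/
def result (A : QueryAlgorithm Ω G m) (f : G → ℝ) (ω : Ω) (g : Fin m → ℝ) : G → ℝ :=
  A.output (ω, A.observations f ω m le_rfl g)

/-- The algorithm with seed law `P`, run with independent noise of law `N(0, v)` in its
observations, recovers every `f` in the family `F` with `‖f‖_D = 1` to within `r` in the norm
`‖h‖_D = (E_{x ∼ D} |h x| ^ 2) ^ (1 / 2)`, with probability at least `p` over the seed and the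
noise. -/
def Recovers (A : QueryAlgorithm Ω G m) (P : Measure Ω) (D : Measure G)
    (F : Submodule ℝ (G → ℝ)) (v : ℝ≥0) (r p : ℝ≥0∞) : Prop :=
  ∀ f ∈ F, eLpNorm f 2 D = 1 →
    p ≤ (P.prod (Measure.pi fun _ : Fin m => gaussianReal 0 v))
      {z | eLpNorm (f - A.result f z.1 z.2) 2 D ≤ r}

end QueryAlgorithm

/-! Let `G` have `d` points with uniform `D`, and let `F` be all functions on `G`. A query sees one
coordinate, so on a function with `f ^ 2 ≤ B` it moves the noise by little. By Hölder, an event of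
probability `p` under the observations of `f` has probability at least `p ^ 4 * exp (-(2 / 3) * B *
m * ε)` under pure noise, even for adaptive queries (`lintegral_observations_pow_four_le`).

Take `N` unit functions such that at most `K` of them lie within `0.1` of any one output. Under pure
noise their success probabilities sum to at most `K`, so `(3 / 4) ^ 4 * N ≤ exp (2 / 3 * B * m * ε)
* K` (`Recovers.card_mul_le`). It remains to find a large enough code. For `d ≥ 12` the sign cube
works, with `B = 1`, `N = 2 ^ d` and an exponential-moment bound for `K`. For `2 ≤ d ≤ 11` it is
replaced by a regular `k`-gon times signs, separated so that `K = 1`. -/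

/-! ### Gaussian shifts and Hölder's inequality -/

theorem gaussianPDFReal_eq_exp_mul (μ : ℝ) {v : ℝ≥0} (hv : v ≠ 0) (x : ℝ) :
    gaussianPDFReal μ v x =
      Real.exp (μ * x / v - μ ^ 2 / (2 * v)) * gaussianPDFReal 0 v x := by
  have hv' : (v : ℝ) ≠ 0 := by exact_mod_cast hv
  simp only [gaussianPDFReal]
  rw [mul_left_comm, ← Real.exp_add]
  congr 2
  field_simp
  ring

theorem lintegral_gaussianReal_eq_lintegral_exp_mul (μ : ℝ) {v : ℝ≥0} (hv : v ≠ 0)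
    {φ : ℝ → ℝ≥0∞} (hφ : Measurable φ) :
    ∫⁻ x, φ x ∂(gaussianReal μ v) =
      ∫⁻ x, φ x * ENNReal.ofReal (Real.exp (μ * x / v - μ ^ 2 / (2 * v))) ∂(gaussianReal 0 v) := by
  rw [gaussianReal_of_var_ne_zero _ hv, gaussianReal_of_var_ne_zero _ hv,
    lintegral_withDensity_eq_lintegral_mul _ (measurable_gaussianPDF _ _) hφ,
    lintegral_withDensity_eq_lintegral_mul _ (measurable_gaussianPDF _ _) (by fun_prop)]
  refine lintegral_congr fun x => ?_
  simp only [Pi.mul_apply, gaussianPDF]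
  rw [gaussianPDFReal_eq_exp_mul μ hv, ENNReal.ofReal_mul (Real.exp_nonneg _)]
  ring

/-- The `a`-th power of the likelihood ratio for shift `μ` is a constant times the ratio for shift
`a * μ`, which integrates to `1`. -/
theorem lintegral_exp_rpow_gaussianReal (μ : ℝ) {v : ℝ≥0} (hv : v ≠ 0) (a : ℝ) :
    ∫⁻ x, ENNReal.ofReal (Real.exp (μ * x / v - μ ^ 2 / (2 * v))) ^ a ∂(gaussianReal 0 v) =
      ENNReal.ofReal (Real.exp (a * (a - 1) * μ ^ 2 / (2 * v))) := by
  have hv' : (v : ℝ) ≠ 0 := by exact_mod_cast hv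
  have key : ∀ x : ℝ, ENNReal.ofReal (Real.exp (μ * x / v - μ ^ 2 / (2 * v))) ^ a =
      ENNReal.ofReal (Real.exp (a * (a - 1) * μ ^ 2 / (2 * v))) *
        ENNReal.ofReal (Real.exp ((a * μ) * x / v - (a * μ) ^ 2 / (2 * v))) := by
    intro x
    rw [ENNReal.ofReal_rpow_of_pos (Real.exp_pos _), ← Real.exp_mul,
      ← ENNReal.ofReal_mul (Real.exp_nonneg _), ← Real.exp_add]
    congr 2
    field_simp
    ring
  simp_rw [key]
  rw [lintegral_const_mul _ (by fun_prop)]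
  have h := lintegral_gaussianReal_eq_lintegral_exp_mul (a * μ) hv
    (φ := fun _ => 1) measurable_const
  simp only [one_mul, lintegral_const, measure_univ, mul_one] at h
  rw [← h, mul_one]

/-- Reverse change of measure for a Gaussian shift, from Hölder's inequality. -/
theorem lintegral_gaussianReal_add_pow_four_le (μ : ℝ) {v : ℝ≥0} (hv : v ≠ 0)
    {φ : ℝ → ℝ≥0∞} (hφ : Measurable φ) :
    (∫⁻ x, φ (μ + x) ∂(gaussianReal 0 v)) ^ 4 ≤
      ENNReal.ofReal (Real.exp (2 / 3 * (μ ^ 2 / v))) * ∫⁻ x, φ x ^ 4 ∂(gaussianReal 0 v) := by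
  have h1 : ∫⁻ x, φ (μ + x) ∂(gaussianReal 0 v) = ∫⁻ x, φ x ∂(gaussianReal μ v) := by
    have := gaussianReal_map_const_add (μ := 0) (v := v) μ
    rw [zero_add] at this
    rw [← this, lintegral_map hφ (by fun_prop)]
  rw [h1, lintegral_gaussianReal_eq_lintegral_exp_mul μ hv hφ]
  -- The ratio enters through its `4 / 3`-th moment, raised to the power `3`: the exponent is `3 *
  -- (4 / 3) * (1 / 3) / 2 = 2 / 3`.
  have hpq : (4 : ℝ).HolderConjugate (4 / 3) := by
    rw [Real.holderConjugate_iff]; norm_num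
  have h2 := ENNReal.lintegral_mul_le_Lp_mul_Lq (gaussianReal 0 v) hpq hφ.aemeasurable
    (g := fun x => ENNReal.ofReal (Real.exp (μ * x / v - μ ^ 2 / (2 * v))))
    (by fun_prop)
  rw [lintegral_exp_rpow_gaussianReal μ hv] at h2
  simp only [Pi.mul_apply] at h2
  calc _ ≤ _ := pow_le_pow_left' h2 4
    _ = _ := by
      rw [mul_pow, ← ENNReal.rpow_natCast, ← ENNReal.rpow_natCast, ← ENNReal.rpow_mul,
        ← ENNReal.rpow_mul, mul_comm, ENNReal.ofReal_rpow_of_pos (Real.exp_pos _),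
        ← Real.exp_mul]
      norm_num
      congr 3
      ring

theorem lintegral_pow_four_le {α : Type*} [MeasurableSpace α] (P : Measure α)
    [IsProbabilityMeasure P] {φ : α → ℝ≥0∞} (hφ : Measurable φ) :
    (∫⁻ x, φ x ∂P) ^ 4 ≤ ∫⁻ x, φ x ^ 4 ∂P := by
  have hpq : (4 : ℝ).HolderConjugate (4 / 3) := by
    rw [Real.holderConjugate_iff]; norm_num
  have h2 := ENNReal.lintegral_mul_le_Lp_mul_Lq P hpq hφ.aemeasurable
    (g := fun _ => 1) (by fun_prop)
  simp only [Pi.mul_apply, mul_one, ENNReal.one_rpow, lintegral_const, measure_univ] at h2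
  calc _ ≤ _ := pow_le_pow_left' h2 4
    _ = _ := by
      rw [← ENNReal.rpow_natCast, ← ENNReal.rpow_mul]
      norm_num

/-! ### Change of measure for adaptive observations -/

theorem measurable_fin_snoc {α : Type*} [MeasurableSpace α] {k : ℕ} {y : α → Fin k → ℝ}
    {u : α → ℝ} (hy : Measurable y) (hu : Measurable u) :
    Measurable fun a => (Fin.snoc (α := fun _ => ℝ) (y a) (u a) : Fin (k + 1) → ℝ) := by
  refine measurable_pi_lambda _ fun i => ?_
  refine Fin.lastCases ?_ (fun j => ?_) i
  · simpa using hu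
  · simpa using measurable_pi_iff.1 hy j

theorem lintegral_pi_fin_succ (γ : Measure ℝ) [SigmaFinite γ] (k : ℕ)
    {φ : (Fin (k + 1) → ℝ) → ℝ≥0∞} (hφ : Measurable φ) :
    ∫⁻ g, φ g ∂(Measure.pi fun _ : Fin (k + 1) => γ) =
      ∫⁻ y, ∫⁻ u, φ (Fin.snoc (α := fun _ => ℝ) y u) ∂γ ∂(Measure.pi fun _ : Fin k => γ) := by
  have h := (measurePreserving_piFinSuccAbove (fun _ : Fin (k + 1) => γ) (Fin.last k)).symm
  rw [← h.lintegral_comp hφ]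
  refine (lintegral_prod_symm _ (hφ.comp h.measurable).aemeasurable).trans ?_
  simp [MeasurableEquiv.piFinSuccAbove_symm_apply, Fin.insertNthEquiv]

namespace QueryAlgorithm

variable {Ω G : Type*} [MeasurableSpace Ω] [MeasurableSpace G] {m : ℕ}

theorem observations_snoc (A : QueryAlgorithm Ω G m) (f : G → ℝ) (ω : Ω) (k : ℕ)
    (hk : k + 1 ≤ m) (y : Fin k → ℝ) (u : ℝ) :
    A.observations f ω (k + 1) hk (Fin.snoc (α := fun _ => ℝ) y u) =
      Fin.snoc (α := fun _ => ℝ) (A.observations f ω k (Nat.le_of_succ_le hk) y)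
        (f (A.query ⟨k, hk⟩ (ω, A.observations f ω k (Nat.le_of_succ_le hk) y)) + u) := by
  simp [observations]

theorem measurable_observations (A : QueryAlgorithm Ω G m) {f : G → ℝ} (hf : Measurable f)
    (k : ℕ) (hk : k ≤ m) :
    Measurable fun z : Ω × (Fin k → ℝ) => A.observations f z.1 k hk z.2 := by
  induction k with
  | zero => exact measurable_const
  | succ k ih =>
    have hy : Measurable fun z : Ω × (Fin (k + 1) → ℝ) =>
        A.observations f z.1 k (Nat.le_of_succ_le hk) (Fin.init z.2) := by
      have : Measurable fun z : Ω × (Fin (k + 1) → ℝ) => (z.1, (Fin.init z.2 : Fin k → ℝ)) :=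
        measurable_fst.prodMk (measurable_pi_lambda _ fun i =>
          (measurable_pi_apply i.castSucc).comp measurable_snd)
      exact (ih (Nat.le_of_succ_le hk)).comp this
    refine measurable_fin_snoc hy (Measurable.add ?_ ?_)
    · exact hf.comp ((A.measurable_query ⟨k, hk⟩).comp (measurable_fst.prodMk hy))
    · exact (measurable_pi_apply _).comp measurable_snd

/-- The observations on `f` compared with pure noise. -/
theorem lintegral_observations_pow_four_le (A : QueryAlgorithm Ω G m) {f : G → ℝ}
    (hf : Measurable f) {B : ℝ} (hB : ∀ x, f x ^ 2 ≤ B) {v : ℝ≥0} (hv : v ≠ 0) (ω : Ω)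
    (k : ℕ) (hk : k ≤ m) {φ : (Fin k → ℝ) → ℝ≥0∞} (hφ : Measurable φ) :
    (∫⁻ g, φ (A.observations f ω k hk g) ∂(Measure.pi fun _ => gaussianReal 0 v)) ^ 4 ≤
      ENNReal.ofReal (Real.exp (2 / 3 * (B / v))) ^ k *
        ∫⁻ g, φ g ^ 4 ∂(Measure.pi fun _ => gaussianReal 0 v) := by
  induction k with
  | zero =>
    have h (g : Fin 0 → ℝ) : A.observations f ω 0 hk g = g := Subsingleton.elim _ _
    simpa [h] using lintegral_pow_four_le _ hφ
  | succ k ih =>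
    have hk' := Nat.le_of_succ_le hk
    set c := ENNReal.ofReal (Real.exp (2 / 3 * (B / v)))
    set x : (Fin k → ℝ) → G := fun y => A.query ⟨k, hk⟩ (ω, y)
    have hx : Measurable x := (A.measurable_query ⟨k, hk⟩).comp measurable_prodMk_left
    have hobs : Measurable fun g => A.observations f ω (k + 1) hk g :=
      (A.measurable_observations hf (k + 1) hk).comp (measurable_prodMk_left (x := ω))
    rw [lintegral_pi_fin_succ _ _ (φ := fun g => φ (A.observations f ω (k + 1) hk g)) (hφ.comp hobs),
      lintegral_pi_fin_succ _ _ (hφ.pow_const 4)]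
    simp only [observations_snoc]
    -- Given the past `y`, the next query point is fixed, so the last observation is a plain
    -- Gaussian shift. The induction hypothesis applies to the average `ψ` over it, and the one-step
    -- bound then controls `ψ ^ 4`.
    set ψ : (Fin k → ℝ) → ℝ≥0∞ := fun y =>
      ∫⁻ u, φ (Fin.snoc (α := fun _ => ℝ) y (f (x y) + u)) ∂(gaussianReal 0 v)
    have hψ : Measurable ψ := by
      refine Measurable.lintegral_prod_right (f := fun y u =>
        φ (Fin.snoc (α := fun _ => ℝ) y (f (x y) + u))) ?_
      exact hφ.comp (measurable_fin_snoc measurable_fst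
        (((hf.comp hx).comp measurable_fst).add measurable_snd))
    refine (ih hk' hψ).trans ?_
    rw [pow_succ, mul_assoc]
    gcongr
    rw [← lintegral_const_mul]
    · refine lintegral_mono fun y => ?_
      refine (lintegral_gaussianReal_add_pow_four_le (f (x y)) hv
        (φ := fun u => φ (Fin.snoc (α := fun _ => ℝ) y u))
        (hφ.comp (measurable_fin_snoc measurable_const measurable_id))).trans ?_
      gcongr
      exact ENNReal.ofReal_le_ofReal (by gcongr; exact hB _)
    · refine Measurable.lintegral_prod_right (f := fun y u =>
        φ (Fin.snoc (α := fun _ => ℝ) y u) ^ 4) ?_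
      exact (hφ.comp (measurable_fin_snoc measurable_fst measurable_snd)).pow_const 4

end QueryAlgorithm

/-! ### The norm of the uniform distribution as a finite sum -/

theorem eLpNorm_two_uniformOn_univ {G : Type*} [Fintype G] [Nonempty G]
    [MeasurableSpace G] [MeasurableSingletonClass G] (h : G → ℝ) :
    eLpNorm h 2 (uniformOn (Set.univ : Set G)) =
      ENNReal.ofReal √((∑ x, h x ^ 2) / Fintype.card G) := by
  have hD : uniformOn (Set.univ : Set G) = (Fintype.card G : ℝ≥0∞)⁻¹ • Measure.count := by
    simp [uniformOn, ProbabilityTheory.cond]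
  have hcard : (0 : ℝ) < Fintype.card G := by exact_mod_cast Fintype.card_pos
  rw [eLpNorm_eq_lintegral_rpow_enorm_toReal two_ne_zero ENNReal.ofNat_ne_top, hD,
    lintegral_smul_measure, lintegral_count, tsum_fintype, Real.sqrt_eq_rpow,
    ← ENNReal.ofReal_rpow_of_nonneg (by positivity) (by positivity), div_eq_inv_mul (∑ x, h x ^ 2),
    ENNReal.ofReal_mul (by positivity), ENNReal.ofReal_inv_of_pos hcard, ENNReal.ofReal_natCast,
    ENNReal.ofReal_sum_of_nonneg fun _ _ => by positivity]
  simp [← ENNReal.ofReal_pow, ← ofReal_norm]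

theorem eLpNorm_two_uniformOn_univ_le_iff {G : Type*} [Fintype G] [Nonempty G]
    [MeasurableSpace G] [MeasurableSingletonClass G] (h : G → ℝ) :
    eLpNorm h 2 (uniformOn (Set.univ : Set G)) ≤ 1 / 10 ↔
      ∑ x, h x ^ 2 ≤ Fintype.card G / 100 := by
  have hcard : (0 : ℝ) < Fintype.card G := by exact_mod_cast Fintype.card_pos
  have h10 : (1 / 10 : ℝ≥0∞) = ENNReal.ofReal (1 / 10) := by
    rw [ENNReal.ofReal_div_of_pos (by norm_num)]; simp
  rw [eLpNorm_two_uniformOn_univ, h10, ENNReal.ofReal_le_ofReal_iff (by norm_num),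
    Real.sqrt_le_left (by norm_num), div_le_iff₀ hcard]
  constructor <;> intro h <;> linarith

theorem eLpNorm_two_uniformOn_univ_eq_one {G : Type*} [Fintype G] [Nonempty G]
    [MeasurableSpace G] [MeasurableSingletonClass G] {h : G → ℝ}
    (hh : ∑ x, h x ^ 2 = Fintype.card G) :
    eLpNorm h 2 (uniformOn (Set.univ : Set G)) = 1 := by
  have hcard : (Fintype.card G : ℝ) ≠ 0 := by exact_mod_cast Fintype.card_ne_zero
  rw [eLpNorm_two_uniformOn_univ, hh, div_self hcard]
  simp

/-! ### The packing bound -/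

namespace QueryAlgorithm

variable {Ω G : Type*} [MeasurableSpace Ω] [MeasurableSpace G] {m : ℕ}

/-- The bound holds for each fixed seed; averaging over seeds costs nothing by convexity of the
fourth power, and an indicator equals its own fourth power. -/
theorem prod_pi_pow_four_le (A : QueryAlgorithm Ω G m) (P : Measure Ω) [IsProbabilityMeasure P]
    {f : G → ℝ} (hf : Measurable f) {B : ℝ} (hB : ∀ x, f x ^ 2 ≤ B) {v : ℝ≥0} (hv : v ≠ 0)
    {S : Set (Ω × (Fin m → ℝ))} (hS : MeasurableSet S) :
    (P.prod (Measure.pi fun _ : Fin m => gaussianReal 0 v))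
        {z | (z.1, A.observations f z.1 m le_rfl z.2) ∈ S} ^ 4 ≤
      ENNReal.ofReal (Real.exp (2 / 3 * (B / v))) ^ m *
        (P.prod (Measure.pi fun _ : Fin m => gaussianReal 0 v)) S := by
  have hT : Measurable fun z : Ω × (Fin m → ℝ) => (z.1, A.observations f z.1 m le_rfl z.2) :=
    measurable_fst.prodMk (A.measurable_observations hf m le_rfl)
  have hφ : Measurable (S.indicator (1 : Ω × (Fin m → ℝ) → ℝ≥0∞)) := measurable_one.indicator hS
  have e1 : (P.prod (Measure.pi fun _ : Fin m => gaussianReal 0 v))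
      {z | (z.1, A.observations f z.1 m le_rfl z.2) ∈ S} =
      ∫⁻ ω, ∫⁻ g, S.indicator (1 : Ω × (Fin m → ℝ) → ℝ≥0∞) (ω, A.observations f ω m le_rfl g)
        ∂(Measure.pi fun _ : Fin m => gaussianReal 0 v) ∂P := by
    refine (lintegral_indicator_one (hT hS)).symm.trans ?_
    exact lintegral_prod _ (hφ.comp hT).aemeasurable
  rw [e1]
  refine (lintegral_pow_four_le P ?_).trans ?_
  · exact Measurable.lintegral_prod_right (f := fun ω g =>
      S.indicator (1 : Ω × (Fin m → ℝ) → ℝ≥0∞) (ω, A.observations f ω m le_rfl g)) (hφ.comp hT)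
  · rw [← lintegral_indicator_one hS, lintegral_prod _ hφ.aemeasurable,
      ← lintegral_const_mul _ (Measurable.lintegral_prod_right
        (f := fun ω g => S.indicator (1 : Ω × (Fin m → ℝ) → ℝ≥0∞) (ω, g)) hφ)]
    refine lintegral_mono fun ω => ?_
    refine (A.lintegral_observations_pow_four_le hf hB hv ω m le_rfl
      (φ := fun g => S.indicator (1 : Ω × (Fin m → ℝ) → ℝ≥0∞) (ω, g))
      (hφ.comp measurable_prodMk_left)).trans ?_
    gcongr with g
    by_cases h : (ω, g) ∈ S <;> simp [h]

theorem Recovers.card_mul_le [Fintype G] [Nonempty G] [MeasurableSingletonClass G]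
    {A : QueryAlgorithm Ω G m} {P : Measure Ω} [IsProbabilityMeasure P] {ε : ℝ} (hε : 0 < ε)
    (hA : A.Recovers P (uniformOn Set.univ) ⊤ (Real.toNNReal (1 / ε)) (1 / 10) (3 / 4))
    {ι : Type*} [Fintype ι] (c : ι → G → ℝ) {B K : ℝ} (hB : ∀ i x, c i x ^ 2 ≤ B)
    (hc : ∀ i, ∑ x, c i x ^ 2 = Fintype.card G)
    (hK : ∀ h : G → ℝ, (Nat.card {i // ∑ x, (c i x - h x) ^ 2 ≤ Fintype.card G / 100} : ℝ) ≤ K) :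
    (3 / 4) ^ 4 * Fintype.card ι ≤ Real.exp (2 / 3 * B * (m * ε)) * K := by
  classical
  set v := Real.toNNReal (1 / ε) with hvdef
  have hv : v ≠ 0 := by simp [v, hε]
  have hvε : B / (v : ℝ) = B * ε := by
    rw [hvdef, Real.coe_toNNReal _ (by positivity)]; field_simp
  set μ := P.prod (Measure.pi fun _ : Fin m => gaussianReal 0 v)
  set S : ι → Set (Ω × (Fin m → ℝ)) := fun i =>
    {p | ∑ x, (c i x - A.output p x) ^ 2 ≤ Fintype.card G / 100} with hSdef
  have hS : ∀ i, MeasurableSet (S i) := fun i => by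
    refine measurableSet_le (Finset.measurable_sum _ fun x _ => ?_) measurable_const
    exact (measurable_const.sub (measurable_pi_iff.1 A.measurable_output x)).pow_const 2
  have h1 : ∀ i, (3 / 4 : ℝ≥0∞) ^ 4 ≤
      ENNReal.ofReal (Real.exp (2 / 3 * (B / v))) ^ m * μ (S i) := by
    intro i
    have h := hA (c i) trivial (eLpNorm_two_uniformOn_univ_eq_one (hc i))
    refine (pow_le_pow_left' h 4).trans ?_
    refine le_trans (le_of_eq ?_)
      (A.prod_pi_pow_four_le P (measurable_of_finite (c i)) (hB i) hv (hS i))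
    congr 2
    ext z
    simp only [Set.mem_ofPred_eq, eLpNorm_two_uniformOn_univ_le_iff, hSdef]
    rfl
  have hK0 : 0 ≤ K := le_trans (Nat.cast_nonneg _) (hK 0)
  have h2 : ∑ i, μ (S i) ≤ ENNReal.ofReal K := by
    simp_rw [← fun i => lintegral_indicator_one (μ := μ) (hS i)]
    rw [← lintegral_finsetSum _ fun i _ => measurable_one.indicator (hS i)]
    refine (lintegral_mono (g := fun _ => ENNReal.ofReal K) fun p => ?_).trans (by simp)
    -- Each transcript `p` yields a single output, which is close to at most `K` codewords.
    have : ∑ i, (S i).indicator (1 : Ω × (Fin m → ℝ) → ℝ≥0∞) p =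
        (Nat.card {i // ∑ x, (c i x - A.output p x) ^ 2 ≤ Fintype.card G / 100} : ℝ≥0∞) := by
      simp [Set.indicator_apply, hSdef, Fintype.card_subtype]
    rw [this, ← ENNReal.ofReal_natCast]
    exact ENNReal.ofReal_le_ofReal (hK _)
  have h3 : (3 / 4 : ℝ≥0∞) ^ 4 * Fintype.card ι ≤
      ENNReal.ofReal (Real.exp (2 / 3 * (B / v))) ^ m * ENNReal.ofReal K :=
    calc (3 / 4 : ℝ≥0∞) ^ 4 * Fintype.card ι = ∑ _i : ι, (3 / 4 : ℝ≥0∞) ^ 4 := by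
          simp [mul_comm]
      _ ≤ _ := Finset.sum_le_sum fun i _ => h1 i
      _ = ENNReal.ofReal (Real.exp (2 / 3 * (B / v))) ^ m * ∑ i, μ (S i) := by
          rw [Finset.mul_sum]
      _ ≤ _ := by gcongr
  rw [← ENNReal.ofReal_pow (Real.exp_nonneg _), ← Real.exp_nat_mul,
    ← ENNReal.ofReal_mul (Real.exp_nonneg _)] at h3
  have h4 := ENNReal.toReal_mono ENNReal.ofReal_ne_top h3
  rw [ENNReal.toReal_ofReal (by positivity)] at h4
  simp only [ENNReal.toReal_mul, ENNReal.toReal_pow, ENNReal.toReal_div, ENNReal.toReal_ofNat,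
    ENNReal.toReal_natCast] at h4
  rw [hvε] at h4
  convert h4 using 3
  ring

end QueryAlgorithm

/-! ### Separated codes and the polygon construction -/

theorem sum_sub_sq_le_of_near {G : Type*} [Fintype G] {f₁ f₂ h : G → ℝ} {r : ℝ}
    (h₁ : ∑ x, (f₁ x - h x) ^ 2 ≤ r) (h₂ : ∑ x, (f₂ x - h x) ^ 2 ≤ r) :
    ∑ x, (f₁ x - f₂ x) ^ 2 ≤ 4 * r := by
  have : ∑ x, (f₁ x - f₂ x) ^ 2 ≤ ∑ x, (2 * (f₁ x - h x) ^ 2 + 2 * (f₂ x - h x) ^ 2) :=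
    Finset.sum_le_sum fun x _ => by nlinarith [sq_nonneg (f₁ x - h x + (f₂ x - h x))]
  rw [Finset.sum_add_distrib, ← Finset.mul_sum, ← Finset.mul_sum] at this
  linarith

theorem card_near_le_one {G ι : Type*} [Fintype G] (c : ι → G → ℝ) {r : ℝ}
    (hc : ∀ i j, i ≠ j → 4 * r < ∑ x, (c i x - c j x) ^ 2) (h : G → ℝ) :
    (Nat.card {i // ∑ x, (c i x - h x) ^ 2 ≤ r} : ℝ) ≤ 1 := by
  have : Subsingleton {i // ∑ x, (c i x - h x) ^ 2 ≤ r} :=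
    ⟨fun i j => Subtype.ext <| by
      by_contra hij
      exact (hc _ _ hij).not_ge (sum_sub_sq_le_of_near i.2 j.2)⟩
  exact_mod_cast Finite.card_le_one_iff_subsingleton.2 this

/-- Adjacent vertices of the polygon are the closest; the symmetry `l ↦ k - l` reduces to angles at
most `π`. -/
theorem cos_two_pi_mul_div_le {l k : ℕ} (hl : 0 < l) (hlk : l < k) :
    Real.cos (2 * Real.pi * l / k) ≤ Real.cos (2 * Real.pi / k) := by
  have hπ := Real.pi_pos
  have hk : (0 : ℝ) < k := by exact_mod_cast hl.trans hlk
  have hl1 : (1 : ℝ) ≤ l := by exact_mod_cast hl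
  have hlk1 : (l : ℝ) + 1 ≤ k := by exact_mod_cast hlk
  rcases le_total (2 * (l : ℝ)) k with h | h
  · refine Real.cos_le_cos_of_nonneg_of_le_pi (by positivity) ?_ ?_
    · rw [div_le_iff₀ hk]; nlinarith
    · exact div_le_div_of_nonneg_right (le_mul_of_one_le_right (by positivity) hl1) hk.le
  · rw [← Real.cos_two_pi_sub]
    refine Real.cos_le_cos_of_nonneg_of_le_pi (by positivity) ?_ ?_
    · rw [sub_le_iff_le_add, ← sub_le_iff_le_add', le_div_iff₀ hk]; nlinarith
    · rw [le_sub_iff_add_le, ← add_div, div_le_iff₀ hk]; nlinarith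

/-- The squared side of the unit `k`-gon is `4 * sin (π / k) ^ 2`. With `q` below `π / k`, the cubic
Taylor bound makes the separation a rational check. -/
theorem four_mul_sq_lt_two_sub_two_mul_cos {k : ℕ} (hk : 2 ≤ k) {q : ℝ} (hq0 : 0 < q)
    (hq1 : q ≤ 1) (hq : q * k ≤ 3.14) :
    4 * (q - q ^ 3 / 6) ^ 2 < 2 - 2 * Real.cos (2 * Real.pi / k) := by
  have hk0 : (2 : ℝ) ≤ k := by exact_mod_cast hk
  have h1 := Real.sin_gt_sub_cube hq0
  have h2 : Real.sin q ≤ Real.sin (Real.pi / k) := by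
    refine Real.sin_le_sin_of_le_of_le_pi_div_two ?_ ?_ ?_
    · linarith [Real.pi_gt_three]
    · exact div_le_div_of_nonneg_left Real.pi_pos.le two_pos hk0
    · rw [le_div_iff₀ (by linarith)]; linarith [Real.pi_gt_d2]
  have h3 : Real.cos (2 * Real.pi / k) = 1 - 2 * Real.sin (Real.pi / k) ^ 2 := by
    rw [mul_div_assoc, Real.cos_two_mul, Real.cos_sq']; ring
  have h4 : 0 ≤ q - q ^ 3 / 6 := by nlinarith [pow_le_one₀ (n := 2) hq0.le hq1, sq_nonneg q]
  rw [h3]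
  have := pow_lt_pow_left₀ (h1.trans_le h2) h4 two_ne_zero
  linarith

/-- A point of a regular `k`-gon in the first two coordinates, signs in the others. -/
noncomputable def polygonSignCode (n k : ℕ) (R : ℝ) (i : Fin k × (Fin n → Bool)) :
    Fin 2 ⊕ Fin n → ℝ :=
  Sum.elim ![R * Real.cos (2 * Real.pi * (i.1 : ℕ) / k), R * Real.sin (2 * Real.pi * (i.1 : ℕ) / k)]
    fun x => if i.2 x then R else -R

theorem polygonSignCode_sq_le (n k : ℕ) (R : ℝ) (i : Fin k × (Fin n → Bool))
    (x : Fin 2 ⊕ Fin n) : polygonSignCode n k R i x ^ 2 ≤ R ^ 2 := by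
  rcases x with x | x
  · fin_cases x
    · simpa [polygonSignCode, mul_pow] using
        mul_le_of_le_one_right (sq_nonneg R) (Real.cos_sq_le_one _)
    · simpa [polygonSignCode, mul_pow] using
        mul_le_of_le_one_right (sq_nonneg R) (Real.sin_sq_le_one _)
  · by_cases h : i.2 x <;> simp [polygonSignCode, h]

theorem sum_polygonSignCode_sq (n k : ℕ) (R : ℝ) (i : Fin k × (Fin n → Bool)) :
    ∑ x, polygonSignCode n k R i x ^ 2 = R ^ 2 * (n + 1) := by
  have h (x : Fin n) : (if i.2 x then R else -R) ^ 2 = R ^ 2 := by split_ifs <;> ring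
  simp only [polygonSignCode, Fintype.sum_sum_type, Sum.elim_inl, Sum.elim_inr, Fin.sum_univ_two,
    h, Matrix.cons_val_zero, Matrix.cons_val_one, Finset.sum_const, Finset.card_univ,
    Fintype.card_fin, nsmul_eq_mul]
  linear_combination R ^ 2 * Real.sin_sq_add_cos_sq (2 * Real.pi * (i.1 : ℕ) / k)

theorem sum_polygonSignCode_sub_sq (n k : ℕ) (R : ℝ) (i j : Fin k × (Fin n → Bool)) :
    ∑ x, (polygonSignCode n k R i x - polygonSignCode n k R j x) ^ 2 =
      R ^ 2 * (2 - 2 * Real.cos (2 * Real.pi * (i.1 : ℕ) / k - 2 * Real.pi * (j.1 : ℕ) / k)) +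
        ∑ x, if i.2 x = j.2 x then 0 else 4 * R ^ 2 := by
  have h (x : Fin n) : ((if i.2 x then R else -R) - (if j.2 x then R else -R)) ^ 2 =
      if i.2 x = j.2 x then 0 else 4 * R ^ 2 := by
    cases i.2 x <;> cases j.2 x <;> simp <;> ring
  simp only [polygonSignCode, Fintype.sum_sum_type, Sum.elim_inl, Sum.elim_inr, Fin.sum_univ_two,
    h, Matrix.cons_val_zero, Matrix.cons_val_one, Real.cos_sub]
  linear_combination R ^ 2 * Real.sin_sq_add_cos_sq (2 * Real.pi * (i.1 : ℕ) / k) +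
    R ^ 2 * Real.sin_sq_add_cos_sq (2 * Real.pi * (j.1 : ℕ) / k)

theorem lt_sum_polygonSignCode_sub_sq {n k : ℕ} {R r : ℝ} (hr : r < 4 * R ^ 2)
    (hk : r < R ^ 2 * (2 - 2 * Real.cos (2 * Real.pi / k))) {i j : Fin k × (Fin n → Bool)}
    (hij : i ≠ j) :
    r < ∑ x, (polygonSignCode n k R i x - polygonSignCode n k R j x) ^ 2 := by
  rw [sum_polygonSignCode_sub_sq]
  have h0 : ∀ x, 0 ≤ if i.2 x = j.2 x then (0 : ℝ) else 4 * R ^ 2 := fun x => by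
    split_ifs <;> positivity
  by_cases h2 : i.2 = j.2
  · have h1 : (i.1 : ℕ) ≠ j.1 := fun h => hij (Prod.ext (Fin.ext h) h2)
    have key : ∀ a b : ℕ, a < b → b < k →
        Real.cos (2 * Real.pi * b / k - 2 * Real.pi * a / k) ≤ Real.cos (2 * Real.pi / k) := by
      intro a b hab hb
      have := cos_two_pi_mul_div_le (Nat.sub_pos_of_lt hab) ((Nat.sub_le b a).trans_lt hb)
      rwa [Nat.cast_sub hab.le, mul_sub, sub_div] at this
    have hcos : Real.cos (2 * Real.pi * (i.1 : ℕ) / k - 2 * Real.pi * (j.1 : ℕ) / k) ≤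
        Real.cos (2 * Real.pi / k) := by
      rcases lt_or_gt_of_ne h1 with h | h
      · rw [← Real.cos_neg, neg_sub]; exact key _ _ h j.1.2
      · exact key _ _ h i.1.2
    have := Finset.sum_nonneg fun x (_ : x ∈ Finset.univ) => h0 x
    nlinarith [sq_nonneg R]
  · obtain ⟨x, hx⟩ := Function.ne_iff.1 h2
    have := Finset.single_le_sum (fun x _ => h0 x) (Finset.mem_univ x)
    rw [if_neg hx] at this
    nlinarith [sq_nonneg R, Real.cos_le_one
      (2 * Real.pi * (i.1 : ℕ) / k - 2 * Real.pi * (j.1 : ℕ) / k)]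

theorem QueryAlgorithm.Recovers.le_of_polygon {n k : ℕ} {q : ℝ} (hk : 2 ≤ k) (hq0 : 0 < q)
    (hq1 : q ≤ 1) (hq : q * k ≤ 3.14) (hn : (n : ℝ) + 1 < 100 * (q - q ^ 3 / 6) ^ 2)
    (hcard : Real.exp (8 * (n + 2) ^ 2 / (15 * (n + 1))) ≤ (3 / 4) ^ 4 * (k * 2 ^ n))
    {ε : ℝ} (hε : 0 < ε) {m : ℕ} {Ω : Type*} [MeasurableSpace Ω] {P : Measure Ω}
    [IsProbabilityMeasure P] [MeasurableSpace (Fin 2 ⊕ Fin n)]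
    [MeasurableSingletonClass (Fin 2 ⊕ Fin n)] {A : QueryAlgorithm Ω (Fin 2 ⊕ Fin n) m}
    (hA : A.Recovers P (uniformOn Set.univ) ⊤ (Real.toNNReal (1 / ε)) (1 / 10) (3 / 4)) :
    0.8 * ((n + 2 : ℕ) : ℝ) / ε ≤ m := by
  -- Normalization forces `R`: the two polygon coordinates together contribute `R ^ 2`, as does each
  -- sign.
  set R : ℝ := √((n + 2) / (n + 1)) with hR
  have hR2 : R ^ 2 = (n + 2) / (n + 1) := Real.sq_sqrt (by positivity)
  have hRn : R ^ 2 * (n + 1) = n + 2 := by rw [hR2]; field_simp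
  have hG : (Fintype.card (Fin 2 ⊕ Fin n) : ℝ) = n + 2 := by simp [add_comm]
  have hpoly := four_mul_sq_lt_two_sub_two_mul_cos hk hq0 hq1 hq
  have hR0 : 0 < R ^ 2 := by rw [hR2]; positivity
  have hsep : 4 * (((Fintype.card (Fin 2 ⊕ Fin n) : ℝ)) / 100) <
      R ^ 2 * (2 - 2 * Real.cos (2 * Real.pi / k)) := by
    rw [hG, ← hRn]; nlinarith
  have hsep' : 4 * (((Fintype.card (Fin 2 ⊕ Fin n) : ℝ)) / 100) < 4 * R ^ 2 := by
    have : (q - q ^ 3 / 6) ^ 2 ≤ 1 := by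
      have : 0 ≤ q - q ^ 3 / 6 := by nlinarith [pow_le_one₀ (n := 2) hq0.le hq1, sq_nonneg q]
      have : q - q ^ 3 / 6 ≤ 1 := by nlinarith [pow_pos hq0 3]
      exact pow_le_one₀ ‹_› this
    rw [hG, ← hRn]; nlinarith
  have key := hA.card_mul_le hε (polygonSignCode n k R) (polygonSignCode_sq_le n k R)
    (fun i => by rw [sum_polygonSignCode_sq, hRn, hG])
    (card_near_le_one _ fun i j hij => lt_sum_polygonSignCode_sub_sq hsep' hsep hij)
  by_contra! hm
  rw [lt_div_iff₀ hε] at hm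
  push_cast at hm
  have hlt : 2 / 3 * R ^ 2 * (m * ε) < 8 * (n + 2) ^ 2 / (15 * (n + 1)) := by
    calc 2 / 3 * R ^ 2 * (m * ε) < 2 / 3 * R ^ 2 * (0.8 * (n + 2)) := by gcongr
      _ = _ := by rw [hR2]; field_simp; ring
  have := Real.exp_lt_exp.2 hlt
  simp only [Fintype.card_prod, Fintype.card_fin, Fintype.card_fun, Fintype.card_bool,
    Nat.cast_mul, Nat.cast_pow, Nat.cast_ofNat, mul_one] at key
  linarith

/-! ### Bounding `exp` by rational powers, and the sign cube -/

theorem exp_le_of_pow_le {p q : ℕ} (hq : q ≠ 0) {x r : ℝ} (hx : x ≤ p / q) (hr : 0 ≤ r)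
    (h : (2.719 : ℝ) ^ p ≤ r ^ q) : Real.exp x ≤ r := by
  refine (Real.exp_le_exp.2 hx).trans (le_of_pow_le_pow_left₀ hq hr ?_)
  rw [← Real.exp_nat_mul, mul_div_cancel₀ _ (by exact_mod_cast hq), ← Real.exp_one_pow]
  refine le_trans ?_ h
  gcongr
  linarith [Real.exp_one_lt_d9]

/-- The vertices of the cube `{-1, 1} ^ d`. -/
def signCode (d : ℕ) (s : Fin d → Bool) (x : Fin d) : ℝ := if s x then 1 else -1

theorem signCode_sq (d : ℕ) (s : Fin d → Bool) (x : Fin d) : signCode d s x ^ 2 = 1 := by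
  by_cases h : s x <;> simp [signCode, h]

/-- The weight factors over coordinates. A flipped sign adds `4` to the squared distance and so
costs `2 ^ (-6)`; the sum is `(1 + 1 / 64) ^ d`. -/
theorem sum_exp_neg_signCode_sub_sq_le (d : ℕ) (t : Fin d → Bool) :
    ∑ s, Real.exp (-(3 / 2 * Real.log 2 * ∑ x, (signCode d s x - signCode d t x) ^ 2)) ≤
      Real.exp (d / 64) := by
  set w : Bool → Bool → ℝ := fun b b' => if b = b' then 1 else 1 / 64 with hw
  have h64 : Real.exp (-(3 / 2 * Real.log 2 * 4)) = 1 / 64 := by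
    rw [show -(3 / 2 * Real.log 2 * 4) = -(Real.log (2 ^ 6)) by rw [Real.log_pow]; push_cast; ring,
      Real.exp_neg, Real.exp_log (by norm_num)]
    norm_num
  have h1 (b b' : Bool) : Real.exp (-(3 / 2 * Real.log 2 *
      ((if b then 1 else -1) - (if b' then (1 : ℝ) else -1)) ^ 2)) = w b b' := by
    have e : ((2 : ℝ)) ^ 2 = 4 := by norm_num
    cases b <;> cases b' <;> simp only [hw] <;> norm_num [e] <;> norm_num at h64 <;> exact h64
  have h2 (b' : Bool) : ∑ b, w b b' = 1 / 64 + 1 := by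
    cases b' <;> simp [hw, add_comm]
  have h3 (s : Fin d → Bool) :
      Real.exp (-(3 / 2 * Real.log 2 * ∑ x, (signCode d s x - signCode d t x) ^ 2)) =
        ∏ x, w (s x) (t x) := by
    simp_rw [← h1]
    rw [← Real.exp_sum, Finset.sum_neg_distrib, ← Finset.mul_sum]
    rfl
  have h4 : ∑ s : Fin d → Bool, ∏ x, w (s x) (t x) = ∏ x, ∑ b, w b (t x) := by
    rw [Finset.prod_univ_sum, Fintype.piFinset_univ]
  simp_rw [h3]
  rw [h4]
  simp_rw [h2]
  rw [Finset.prod_const, Finset.card_univ, Fintype.card_fin,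
    show (d : ℝ) / 64 = d * (1 / 64) by ring, Real.exp_nat_mul]
  exact pow_le_pow_left₀ (by norm_num) (Real.add_one_le_exp _) d

/-- A Chernoff-type count around one near codeword `t`: all others are within squared distance `4 *
d / 100` of `t`, so each has weight at least `exp (-(d * (3 / 50 * log 2)))`. -/
theorem card_signCode_near_le (d : ℕ) (h : Fin d → ℝ) :
    (Nat.card {s // ∑ x, (signCode d s x - h x) ^ 2 ≤ d / 100} : ℝ) ≤
      Real.exp (d * (1 / 64 + 3 / 50 * Real.log 2)) := by
  classical
  rw [Nat.card_eq_fintype_card, Fintype.card_subtype]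
  set T := Finset.univ.filter fun s : Fin d → Bool => ∑ x, (signCode d s x - h x) ^ 2 ≤ d / 100
    with hT
  rcases T.eq_empty_or_nonempty with hE | ⟨t, ht⟩
  · rw [hE]
    simpa using Real.exp_nonneg _
  have hlog : 0 < Real.log 2 := Real.log_pos one_lt_two
  set W : (Fin d → Bool) → ℝ := fun s =>
    Real.exp (-(3 / 2 * Real.log 2 * ∑ x, (signCode d s x - signCode d t x) ^ 2)) with hW
  have hone : ∀ s ∈ T, 1 ≤ Real.exp (d * (3 / 50 * Real.log 2)) * W s := by
    intro s hs
    have h1 := sum_sub_sq_le_of_near (Finset.mem_filter.1 hs).2 (Finset.mem_filter.1 ht).2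
    rw [hW, ← Real.exp_add]
    refine Real.one_le_exp ?_
    have := mul_le_mul_of_nonneg_left h1 hlog.le
    linarith
  calc (T.card : ℝ) = ∑ _s ∈ T, (1 : ℝ) := by simp
    _ ≤ ∑ s ∈ T, Real.exp (d * (3 / 50 * Real.log 2)) * W s := Finset.sum_le_sum hone
    _ ≤ ∑ s, Real.exp (d * (3 / 50 * Real.log 2)) * W s :=
        Finset.sum_le_univ_sum_of_nonneg fun s =>
          mul_nonneg (Real.exp_nonneg _) (Real.exp_nonneg _)
    _ = Real.exp (d * (3 / 50 * Real.log 2)) * ∑ s, W s := by rw [Finset.mul_sum]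
    _ ≤ Real.exp (d * (3 / 50 * Real.log 2)) * Real.exp (d / 64) := by
        gcongr
        exact sum_exp_neg_signCode_sub_sq_le d t
    _ = _ := by
        rw [← Real.exp_add]
        congr 1
        ring

theorem QueryAlgorithm.Recovers.le_of_cube {d : ℕ} (hd : 12 ≤ d)
    {ε : ℝ} (hε : 0 < ε) {m : ℕ} {Ω : Type*} [MeasurableSpace Ω] {P : Measure Ω}
    [IsProbabilityMeasure P] [MeasurableSpace (Fin d)]
    [MeasurableSingletonClass (Fin d)] {A : QueryAlgorithm Ω (Fin d) m}
    (hA : A.Recovers P (uniformOn Set.univ) ⊤ (Real.toNNReal (1 / ε)) (1 / 10) (3 / 4)) :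
    0.8 * (d : ℝ) / ε ≤ m := by
  have : Nonempty (Fin d) := ⟨⟨0, by omega⟩⟩
  have hd' : (12 : ℝ) ≤ d := by exact_mod_cast hd
  have key := hA.card_mul_le hε (signCode d) (fun s x => (signCode_sq d s x).le)
    (fun s => by simp [signCode_sq]) (K := Real.exp (d * (1 / 64 + 3 / 50 * Real.log 2)))
    (fun h => by rw [Fintype.card_fin]; exact card_signCode_near_le d h)
  by_contra! hm
  rw [lt_div_iff₀ hε] at hm
  have hlog := Real.log_two_gt_d9
  have h2 : ((Fintype.card (Fin d → Bool) : ℕ) : ℝ) = Real.exp (d * Real.log 2) := by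
    rw [Real.exp_nat_mul, Real.exp_log two_pos]; simp
  have h3 : Real.exp (-(6 / 5)) < (3 / 4) ^ 4 := by
    rw [Real.exp_neg, inv_lt_comm₀ (Real.exp_pos _) (by norm_num)]
    refine lt_of_pow_lt_pow_left₀ 5 (Real.exp_nonneg _) ?_
    rw [← Real.exp_nat_mul]
    norm_num
    rw [← mul_one (6 : ℝ), show (6 : ℝ) * 1 = ((6 : ℕ) : ℝ) * 1 by norm_num, Real.exp_nat_mul]
    refine lt_of_lt_of_le (b := (2.718 : ℝ) ^ 6) (by norm_num) ?_
    gcongr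
    linarith [Real.exp_one_gt_d9]
  rw [h2, ← Real.exp_add] at key
  -- As `m * ε < 0.8 * d`, the slack per dimension is `0.94 * log 2 - 8 / 15 - 1 / 64 > 0.1`; with
  -- `d ≥ 12` it pays for the `6 / 5` that covers `(3 / 4) ^ 4`.
  have h4 : 2 / 3 * 1 * (m * ε) + d * (1 / 64 + 3 / 50 * Real.log 2) ≤
      -(6 / 5) + d * Real.log 2 := by nlinarith
  have h5 := Real.exp_le_exp.2 h4
  rw [Real.exp_add (-(6 / 5))] at h5
  have h6 := mul_lt_mul_of_pos_right h3 (Real.exp_pos (d * Real.log 2))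
  linarith
-- Low-dimensional parameters and the main theorem
theorem exists_polygon_parameters {n : ℕ} (hn : n < 10) :
    ∃ (k : ℕ) (q : ℝ), 2 ≤ k ∧ 0 < q ∧ q ≤ 1 ∧ q * k ≤ 3.14 ∧
      (n : ℝ) + 1 < 100 * (q - q ^ 3 / 6) ^ 2 ∧
      Real.exp (8 * (n + 2) ^ 2 / (15 * (n + 1))) ≤ (3 / 4) ^ 4 * (k * 2 ^ n) := by
  -- The real parameter is `3.14 / k`; the naturals `p` and `q` here only give a fraction above the
  -- exponent, and `2.719` exceeds `e`.
  suffices h : ∃ k p q : ℕ, 2 ≤ k ∧ 3.14 / (k : ℝ) ≤ 1 ∧ q ≠ 0 ∧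
      (n : ℝ) + 1 < 100 * (3.14 / (k : ℝ) - (3.14 / (k : ℝ)) ^ 3 / 6) ^ 2 ∧
      8 * ((n : ℝ) + 2) ^ 2 / (15 * (n + 1)) ≤ p / q ∧
      (2.719 : ℝ) ^ p ≤ ((3 / 4) ^ 4 * (k * 2 ^ n)) ^ q by
    obtain ⟨k, p, q, hk, hk1, hq, hn', hx, hp⟩ := h
    have hk0 : (0 : ℝ) < k := by exact_mod_cast two_pos.trans_le hk
    exact ⟨k, 3.14 / k, hk, by positivity, hk1, by rw [div_mul_cancel₀ _ hk0.ne'], hn',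
      exp_le_of_pow_le hq hx (by positivity) hp⟩
  interval_cases n
  · exact ⟨30, 11, 5, by norm_num⟩
  · exact ⟨20, 12, 5, by norm_num⟩
  · exact ⟨15, 29, 10, by norm_num⟩
  · exact ⟨15, 7, 2, by norm_num⟩
  · exact ⟨10, 39, 10, by norm_num⟩
  · exact ⟨9, 22, 5, by norm_num⟩
  · exact ⟨9, 5, 1, by norm_num⟩
  · exact ⟨9, 11, 2, by norm_num⟩
  · exact ⟨9, 6, 1, by norm_num⟩
  · exact ⟨9, 13, 2, by norm_num⟩

theorem mainTheorem6 (d : ℕ) (hd : d ≠ 1) (ε : ℝ) (hε0 : 0 < ε) (hε : ε < 1 / 10) :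
    ∃ (G : Type) (_ : MeasurableSpace G) (D : Measure G) (F : Submodule ℝ (G → ℝ)),
      Finite G ∧ MeasurableSingletonClass G ∧ IsProbabilityMeasure D ∧
      Module.finrank ℝ F = d ∧
      ∀ (m : ℕ) (Ω : Type*) [MeasurableSpace Ω] (P : Measure Ω) [IsProbabilityMeasure P]
        (A : QueryAlgorithm Ω G m),
        A.Recovers P D F (Real.toNNReal (1 / ε)) (1 / 10) (3 / 4) →
          0.8 * (d : ℝ) / ε ≤ (m : ℝ) := by
  by_cases hd0 : d = 0
  · subst hd0
    -- In dimension zero the claimed bound is just `0 ≤ m`.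
    refine ⟨Unit, ⊤, Measure.dirac (), ⊥, inferInstance, inferInstance, inferInstance,
      by simp, ?_⟩
    intros
    simp
  rcases le_or_gt 12 d with h12 | h12
  · have : Nonempty (Fin d) := ⟨⟨0, by omega⟩⟩
    refine ⟨Fin d, ⊤, uniformOn Set.univ, ⊤, inferInstance, inferInstance, inferInstance,
      by simp, ?_⟩
    intro m Ω _ P _ A hA
    exact hA.le_of_cube h12 hε0
  · obtain ⟨n, rfl⟩ : ∃ n, d = n + 2 := ⟨d - 2, by omega⟩
    obtain ⟨k, q, hk, hq0, hq1, hq, hn, hcard⟩ := exists_polygon_parameters (n := n) (by omega)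
    let _ : MeasurableSpace (Fin 2 ⊕ Fin n) := ⊤
    have : MeasurableSingletonClass (Fin 2 ⊕ Fin n) := ⟨fun _ => trivial⟩
    refine ⟨Fin 2 ⊕ Fin n, inferInstance, uniformOn Set.univ, ⊤, inferInstance, inferInstance,
      inferInstance, by simp [add_comm], ?_⟩
    intro m Ω _ P _ A hA
    exact hA.le_of_polygon hk hq0 hq1 hq hn hcard hε0
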